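/- For $n\ge 0$ let $\mathbb{I}^n=\{0,1\}^n$ with the product order. Let $\square$ be the category of cubes: its objects are $\mathbb{I}^0,\mathbb{I}^1,\mathbb{I}^2,\dots$, and its morphisms $\mathbb{I}^p\to\mathbb{I}^q$ are the nondecreasing maps that are compositions of (possibly no) face maps $\delta_i^{k,\tau}:\mathbb{I}^{k-1}\to\mathbb{I}^k$, $(x_1,\dots,x_{k-1})\mapsto(x_1,\dots,x_{i-1},\tau,x_i,\dots,x_{k-1})$, and degeneracy maps $\epsilon_i^k:\mathbb{I}^k\to\mathbb{I}^{k-1}$, $(x_1,\dots,x_k)\mapsto(x_1,\dots,x_{i-1},x_{i+1},\dots,x_k)$, where $k\ge 1$, $1\le i\le k$ and $\tau\in\{0,1\}$. A cubical Abelian group is a functor $F:\square^{op}\to\mathrm{Ab}$. For $k\ge 0$ let $D_k(F)=\sum_{i=1}^k \mathrm{Im}\,F(\epsilon_i^k)\subseteq F(\mathbb{I}^k)$ (so $D_0(F)=0$). The normalized complex $C^N_*(F)$ consists of the groups $C^N_k(F)=F(\mathbb{I}^k)/D_k(F)$ for $k\ge 0$ and $C^N_k(F)=0$ for $k<0$,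 with the differentials induced, for $k\ge 1$, by $d_k=\sum_{i=1}^k(-1)^i\bigl(F(\delta_i^{k,0})-F(\delta_i^{k,1})\bigr):F(\mathbb{I}^k)\to F(\mathbb{I}^{k-1})$. Let $\varinjlim_n^{\square^{op}}:\mathrm{Ab}^{\square^{op}}\to\mathrm{Ab}$ denote the $n$-th left derived functor of the colimit functor $\varinjlim^{\square^{op}}:\mathrm{Ab}^{\square^{op}}\to\mathrm{Ab}$. Then for every cubical Abelian group $F$ and every integer $n\ge 0$ there is an isomorphism of Abelian groups $$H_n(C^N_*(F))\;\cong\;\varinjlim\nolimits_n^{\square^{op}}F.$$ -/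

import Mathlib

open CategoryTheory CategoryTheory.Limits Opposite

universe u

/-- The set of vertices of the `n`-dimensional cube `𝕀ⁿ = {0, 1}ⁿ`, with the product order. -/
abbrev CubeVertices (n : ℕ) : Type := Fin n → Fin 2

/-- The face map `𝕀ⁿ → 𝕀ⁿ⁺¹` inserting the value `τ` at the position `i`
(positions are numbered from `0`). -/
def faceMap {n : ℕ} (i : Fin (n + 1)) (τ : Fin 2) : CubeVertices n →o CubeVertices (n + 1) where
  toFun x := Fin.insertNth (α := fun _ => Fin 2) i τ x
  monotone' x y h := by
    rw [Fin.insertNth_le_iff]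
    refine ⟨by simp, fun j => ?_⟩
    simpa using h j

/-- The degeneracy map `𝕀ⁿ⁺¹ → 𝕀ⁿ` deleting the coordinate at the position `i`
(positions are numbered from `0`). -/
def degeneracyMap {n : ℕ} (i : Fin (n + 1)) : CubeVertices (n + 1) →o CubeVertices n where
  toFun x := Fin.removeNth (α := fun _ => Fin 2) i x
  monotone' _ _ h j := h (i.succAbove j)

/-- The nondecreasing maps `𝕀ᵖ → 𝕀^q` that are compositions of (possibly no) face maps and
degeneracy maps. -/
inductive IsCubical : ∀ {p q : ℕ}, (CubeVertices p →o CubeVertices q) → Prop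
  | id (p : ℕ) : IsCubical (OrderHom.id : CubeVertices p →o CubeVertices p)
  | face {n : ℕ} (i : Fin (n + 1)) (τ : Fin 2) : IsCubical (faceMap i τ)
  | degeneracy {n : ℕ} (i : Fin (n + 1)) : IsCubical (degeneracyMap i)
  | comp {p q r : ℕ} {g : CubeVertices q →o CubeVertices r}
      {f : CubeVertices p →o CubeVertices q} :
      IsCubical g → IsCubical f → IsCubical (g.comp f)

/-- The objects of the category of cubes: the cubes `𝕀⁰, 𝕀¹, 𝕀², …`. -/
structure Cube : Type where
  /-- The dimension of the cube. -/
  dim : ℕ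

namespace Cube

/-- The morphisms of the category of cubes. -/
@[ext]
structure Hom (a b : Cube) : Type where
  /-- The underlying nondecreasing map. -/
  map : CubeVertices a.dim →o CubeVertices b.dim
  isCubical : IsCubical map

/-- The category of cubes `□`. -/
instance : SmallCategory Cube where
  Hom := Hom
  id a := ⟨OrderHom.id, IsCubical.id a.dim⟩
  comp f g := ⟨g.map.comp f.map, IsCubical.comp g.isCubical f.isCubical⟩

/-- The face morphism `𝕀ⁿ ⟶ 𝕀ⁿ⁺¹` inserting `τ` at the position `i`. -/
def δ {n : ℕ} (i : Fin (n + 1)) (τ : Fin 2) : (⟨n⟩ : Cube) ⟶ ⟨n + 1⟩ :=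
  (⟨faceMap i τ, IsCubical.face i τ⟩ : Hom ⟨n⟩ ⟨n + 1⟩)

/-- The degeneracy morphism `𝕀ⁿ⁺¹ ⟶ 𝕀ⁿ` deleting the coordinate at the position `i`. -/
def ε {n : ℕ} (i : Fin (n + 1)) : (⟨n + 1⟩ : Cube) ⟶ ⟨n⟩ :=
  (⟨degeneracyMap i, IsCubical.degeneracy i⟩ : Hom ⟨n + 1⟩ ⟨n⟩)

lemma hom_ext {a b : Cube} {f g : a ⟶ b} (h : ∀ x, Hom.map f x = Hom.map g x) : f = g :=
  Hom.ext (OrderHom.ext _ _ (funext h))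

lemma δ_comp_δ {n : ℕ} (i j : Fin (n + 1)) (h : i ≤ j) (α β : Fin 2) :
    δ i α ≫ δ j.succ β = δ j β ≫ δ i.castSucc α := by
  refine hom_ext fun x => ?_
  change Fin.insertNth (α := fun _ => Fin 2) j.succ β
      (Fin.insertNth (α := fun _ => Fin 2) i α x) =
    Fin.insertNth (α := fun _ => Fin 2) i.castSucc α
      (Fin.insertNth (α := fun _ => Fin 2) j β x)
  have h₁ : i.castSucc.succAbove j = j.succ := Fin.succAbove_of_le_castSucc _ _ h
  have h₂ : j.succ.succAbove i = i.castSucc :=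
    Fin.succAbove_of_castSucc_lt _ _ (Fin.castSucc_lt_succ_iff.2 h)
  have h₃ : j.predAbove i.castSucc = i := by
    rw [Fin.predAbove_of_le_castSucc _ _ h, Fin.castPred_castSucc]
  symm
  rw [Fin.eq_insertNth_iff, Fin.eq_insertNth_iff]
  refine ⟨?_, ?_, funext fun m => ?_⟩
  · rw [← h₁, Fin.insertNth_apply_succAbove, Fin.insertNth_apply_same]
  · rw [Fin.removeNth_apply, h₂, Fin.insertNth_apply_same]
  · have h₄ := Fin.succAbove_succAbove_succAbove_predAbove i.castSucc j m
    rw [h₁, h₃] at h₄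
    rw [Fin.removeNth_apply, Fin.removeNth_apply, h₄, Fin.insertNth_apply_succAbove,
      Fin.insertNth_apply_succAbove]

lemma δ_comp_ε_self {n : ℕ} (i : Fin (n + 1)) (τ : Fin 2) : δ i τ ≫ ε i = 𝟙 _ :=
  hom_ext fun x => Fin.removeNth_insertNth (α := fun _ => Fin 2) i τ x

lemma δ_comp_ε_of_ne {n : ℕ} (i j : Fin (n + 2)) (h : i ≠ j) :
    ∃ i' j' : Fin (n + 1), ∀ τ : Fin 2, δ i τ ≫ ε j = ε j' ≫ δ i' τ := by
  obtain ⟨i', rfl⟩ := Fin.exists_succAbove_eq h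
  refine ⟨i', i'.predAbove j, fun τ => hom_ext fun x => ?_⟩
  change Fin.removeNth (α := fun _ => Fin 2) j
      (Fin.insertNth (α := fun _ => Fin 2) (j.succAbove i') τ x) =
    Fin.insertNth (α := fun _ => Fin 2) i' τ
      (Fin.removeNth (α := fun _ => Fin 2) (i'.predAbove j) x)
  rw [Fin.eq_insertNth_iff]
  refine ⟨by simp [Fin.removeNth_apply], funext fun m => ?_⟩
  rw [Fin.removeNth_apply, Fin.removeNth_apply, Fin.removeNth_apply,
    ← Fin.succAbove_succAbove_succAbove_predAbove, Fin.insertNth_apply_succAbove]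

end Cube

/-- A cubical Abelian group: a functor `□ᵒᵖ ⥤ Ab`. -/
abbrev CubicalAbGroup : Type (u + 1) := Cubeᵒᵖ ⥤ AddCommGrpCat.{u}

namespace CubicalAbGroup

variable (F : CubicalAbGroup.{u})

/-- The group `F(𝕀ⁿ)` of `n`-chains. -/
abbrev chains (n : ℕ) : AddCommGrpCat.{u} := F.obj (op ⟨n⟩)

/-- The differential `d = ∑ᵢ (-1)ⁱ (F(δᵢ⁰) - F(δᵢ¹)) : F(𝕀ⁿ⁺¹) ⟶ F(𝕀ⁿ)`. The positions are
numbered from `0` here and from `1` in the usual formula, hence the exponent `i + 1`. -/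
def d (n : ℕ) : F.chains (n + 1) ⟶ F.chains n :=
  ∑ i : Fin (n + 1), (-1 : ℤ) ^ ((i : ℕ) + 1) •
    (F.map (Cube.δ i 0).op - F.map (Cube.δ i 1).op)

/-- The subgroup `Dₙ(F) ⊆ F(𝕀ⁿ)` of degenerate chains: the sum of the images of the
homomorphisms `F(εᵢ)`. -/
def degenerate : ∀ n : ℕ, AddSubgroup (F.chains n)
  | 0 => ⊥
  | n + 1 => ⨆ i : Fin (n + 1), (F.map (Cube.ε i).op).hom.range

lemma comp_eq_neg_comp {C : Type*} [Category* C] [Preadditive C] {A B B' D : C}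
    {x₀ x₁ : A ⟶ B} {y₀ y₁ : B ⟶ D} {x₀' x₁' : A ⟶ B'} {y₀' y₁' : B' ⟶ D} {a b a' b' : ℤ}
    (h₀₀ : x₀ ≫ y₀ = x₀' ≫ y₀') (h₀₁ : x₀ ≫ y₁ = x₁' ≫ y₀') (h₁₀ : x₁ ≫ y₀ = x₀' ≫ y₁')
    (h₁₁ : x₁ ≫ y₁ = x₁' ≫ y₁') (hab : a * b = -(a' * b')) :
    (a • (x₀ - x₁)) ≫ (b • (y₀ - y₁)) = -((a' • (x₀' - x₁')) ≫ (b' • (y₀' - y₁'))) := by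
  rw [Preadditive.zsmul_comp, Preadditive.comp_zsmul, Preadditive.zsmul_comp,
    Preadditive.comp_zsmul, smul_smul, smul_smul, hab, neg_smul]
  congr 2
  simp only [Preadditive.sub_comp, Preadditive.comp_sub, h₀₀, h₀₁, h₁₀, h₁₁]
  abel

lemma d_comp_d (n : ℕ) : F.d (n + 1) ≫ F.d n = 0 := by
  simp only [d, Preadditive.comp_sum, Preadditive.sum_comp, ← Finset.sum_product']
  let P := Fin (n + 1) × Fin (n + 2)
  let S : Finset P := {ij : P | (ij.2 : ℕ) ≤ (ij.1 : ℕ)}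
  rw [Finset.univ_product_univ, ← Finset.sum_add_sum_compl S, ← eq_neg_iff_add_eq_zero,
    ← Finset.sum_neg_distrib]
  let φ : ∀ ij : P, ij ∈ S → P := fun ij hij =>
    (Fin.castLT ij.2 (lt_of_le_of_lt (Finset.mem_filter.mp hij).right (Fin.is_lt ij.1)),
      ij.1.succ)
  apply Finset.sum_bij φ
  · intro ij hij
    simp_rw [S, φ, Finset.compl_filter, Finset.mem_filter_univ, Fin.val_succ,
      Fin.val_castLT] at hij ⊢
    lia
  · rintro ⟨i, j⟩ hij ⟨i', j'⟩ hij' h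
    rw [Prod.mk_inj]
    exact ⟨by simpa [φ] using! congr_arg Prod.snd h,
      by simpa [φ, Fin.castSucc_castLT] using! congr_arg Fin.castSucc (congr_arg Prod.fst h)⟩
  · rintro ⟨i', j'⟩ hij'
    simp_rw [S, Finset.compl_filter, Finset.mem_filter_univ, not_le] at hij'
    refine ⟨(j'.pred <| ?_, Fin.castSucc i'), ?_, ?_⟩
    · rintro rfl
      simp only [Fin.val_zero, not_lt_zero] at hij'
    · simpa [S] using! Nat.le_sub_one_of_lt hij'
    · simp only [φ, Fin.castLT_castSucc, Fin.succ_pred]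
  · rintro ⟨i, j⟩ hij
    have hij' : (j : ℕ) ≤ (i : ℕ) := (Finset.mem_filter.mp hij).right
    obtain ⟨k, rfl⟩ : ∃ k : Fin (n + 1), j = k.castSucc :=
      ⟨j.castLT (lt_of_le_of_lt hij' i.is_lt), by simp⟩
    have key : ∀ α β : Fin 2, F.map (Cube.δ k.castSucc α).op ≫ F.map (Cube.δ i β).op =
        F.map (Cube.δ i.succ β).op ≫ F.map (Cube.δ k α).op := fun α β => by
      rw [← F.map_comp, ← F.map_comp, ← op_comp, ← op_comp,
        Cube.δ_comp_δ k i (by exact hij')]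
    refine comp_eq_neg_comp (key 0 0) (key 0 1) (key 1 0) (key 1 1) ?_
    simp only [φ, Fin.castLT_castSucc, Fin.val_succ, Fin.val_castSucc]
    ring

lemma degenerate_le_comap_d (n : ℕ) :
    F.degenerate (n + 1) ≤ (F.degenerate n).comap (F.d n).hom := by
  refine iSup_le fun j => ?_
  rintro _ ⟨y, rfl⟩
  change (F.d n).hom ((F.map (Cube.ε j).op).hom y) ∈ F.degenerate n
  have hd : (F.d n).hom ((F.map (Cube.ε j).op).hom y) =
      ∑ i : Fin (n + 1), (-1 : ℤ) ^ ((i : ℕ) + 1) •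
        ((F.map (Cube.δ i 0 ≫ Cube.ε j).op).hom y - (F.map (Cube.δ i 1 ≫ Cube.ε j).op).hom y) := by
    let ev : (F.chains (n + 1) ⟶ F.chains n) →+ F.chains n :=
      { toFun := fun f => f.hom ((F.map (Cube.ε j).op).hom y)
        map_zero' := rfl
        map_add' := fun _ _ => rfl }
    refine (map_sum ev _ _).trans (Finset.sum_congr rfl fun i _ => ?_)
    refine (map_zsmul ev _ _).trans (congrArg _ ((map_sub ev _ _).trans ?_))
    rw [op_comp, op_comp, F.map_comp, F.map_comp]
    rfl
  rw [hd]
  refine sum_mem fun i _ => zsmul_mem ?_ _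
  by_cases h : i = j
  · subst h
    rw [Cube.δ_comp_ε_self, Cube.δ_comp_ε_self, sub_self]
    exact zero_mem _
  · cases n with
    | zero => exact absurd (Subsingleton.elim (α := Fin 1) i j) h
    | succ n =>
      obtain ⟨i', j', h'⟩ := Cube.δ_comp_ε_of_ne i j h
      have hmem : ∀ τ : Fin 2, (F.map (Cube.δ i τ ≫ Cube.ε j).op).hom y ∈
          F.degenerate (n + 1) := fun τ => by
        rw [h', op_comp, F.map_comp]
        exact AddSubgroup.mem_iSup_of_mem j' ⟨(F.map (Cube.δ i' τ).op).hom y, rfl⟩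
      exact sub_mem (hmem 0) (hmem 1)

/-- The group `Cᴺₙ(F) = F(𝕀ⁿ) / Dₙ(F)` of normalized `n`-chains. -/
def normalizedChains (n : ℕ) : AddCommGrpCat.{u} :=
  AddCommGrpCat.of (F.chains n ⧸ F.degenerate n)

/-- The differential `x + Dₙ₊₁(F) ↦ d x + Dₙ(F)` of the normalized complex. -/
def normalizedD (n : ℕ) : F.normalizedChains (n + 1) ⟶ F.normalizedChains n :=
  AddCommGrpCat.ofHom
    (QuotientAddGroup.map (F.degenerate (n + 1)) (F.degenerate n) (F.d n).hom
      (F.degenerate_le_comap_d n))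

lemma normalizedD_comp_normalizedD (n : ℕ) :
    F.normalizedD (n + 1) ≫ F.normalizedD n = 0 := by
  ext x
  obtain ⟨x, rfl⟩ := QuotientAddGroup.mk_surjective x
  change (((F.d (n + 1) ≫ F.d n).hom x : F.chains n) : F.chains n ⧸ F.degenerate n) = 0
  rw [d_comp_d]
  rfl

/-- The normalized complex `Cᴺ(F)` of a cubical Abelian group, concentrated in degrees `≥ 0`. -/
noncomputable def normalizedComplex : ChainComplex AddCommGrpCat.{u} ℕ :=
  ChainComplex.of F.normalizedChains F.normalizedD F.normalizedD_comp_normalizedD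

end CubicalAbGroup

lemma enoughProjectives_addCommGrpCat : EnoughProjectives AddCommGrpCat.{u} :=
  ((forget₂ (ModuleCat.{u} ℤ) AddCommGrpCat.{u}).asEquivalence.enoughProjectives_iff).1
    inferInstance

/-- The category of diagrams of Abelian groups on a small category has enough projectives, so
that left derived functors are defined on it. -/
instance enoughProjectives_functor_addCommGrpCat {J : Type} [SmallCategory J] :
    EnoughProjectives (J ⥤ AddCommGrpCat.{u}) where
  presentation X := by
    have := enoughProjectives_addCommGrpCat.{u}
    let L (c : J) := evaluationLeftAdjoint AddCommGrpCat.{u} c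
    let adj (c : J) := evaluationAdjunctionRight AddCommGrpCat.{u} c
    let P (c : J) : J ⥤ AddCommGrpCat.{u} := (L c).obj (Projective.over (X.obj c))
    have (c : J) : Projective (P c) := (adj c).map_projective _ inferInstance
    let f (c : J) : P c ⟶ X := ((adj c).homEquiv _ _).symm (Projective.π (X.obj c))
    have hf (c : J) : Epi ((f c).app c) := by
      have h : (adj c).unit.app _ ≫ (f c).app c = Projective.π (X.obj c) :=
        ((adj c).homEquiv_unit _ _ _).symm.trans (((adj c).homEquiv _ _).apply_symm_apply _)
      exact epi_of_epi_fac h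
    have hs : Epi (Sigma.desc f) := by
      rw [NatTrans.epi_iff_epi_app]
      intro c
      have h : (Sigma.ι P c).app c ≫ (Sigma.desc f).app c = (f c).app c := by
        rw [← NatTrans.comp_app, Sigma.ι_desc]
      have := hf c
      exact epi_of_epi_fac h
    have hp : Projective (∐ P) :=
      { factors := fun f e _ =>
          ⟨Sigma.desc fun c => Projective.factorThru (Sigma.ι P c ≫ f) e,
            Sigma.hom_ext _ _ fun c => by
              rw [Sigma.ι_desc_assoc, Projective.factorThru_comp]⟩ }
    exact ⟨{ p := ∐ P, f := Sigma.desc f }⟩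

/-- The left derived functors `colimₙ : (J ⥤ Ab) ⥤ Ab` of the colimit functor
`colim : (J ⥤ Ab) ⥤ Ab` on the diagrams of Abelian groups on a small category `J`. -/
noncomputable def colimDerived (J : Type) [SmallCategory J] (n : ℕ) :
    (J ⥤ AddCommGrpCat.{u}) ⥤ AddCommGrpCat.{u} :=
  (colim : (J ⥤ AddCommGrpCat.{u}) ⥤ AddCommGrpCat.{u}).leftDerived n

/-! A functor `N` from an Abelian category with enough projectives to chain complexes computes the
left derived functors of `L` as soon as it is exact, has homology zero in positive degrees on
projectives, and has zeroth homology naturally isomorphic to the right exact functor `L`. This is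
proved by dimension shifting along a projective resolution (`nonempty_homology_iso_leftDerived`) and
applied to the normalized complex and `colim`.

Exactness: on `F(𝕀ⁿ)` the commuting operators "set coordinate i to 0" give the natural endomorphism
`∏ᵢ (1 - setZero i)`. It kills the degenerate chains and is the identity modulo them, so normalized
chains are a natural direct summand of `F(𝕀ⁿ)` (`shortExact_map_normalized`).

Acyclicity: a projective is a retract of a free cubical group, a free one is a direct sum of
standard cubes, and a standard cube is contracted one coordinate at a time
(`standardCube.hasContraction`). The homotopy rests on a trichotomy for maps into `𝕀^(q+1)`
according to the first coordinate: constant, the first input, or a later input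
(`Cube.eq_face_or_cons_or_degenerate`).

Degree zero: any two vertices of a cube are joined by edges, so the colimit is the group of vertices
modulo boundaries of edges (`exact_normalizedToColim`, `epi_normalizedToColim`). -/

/-! ### Combinatorics of the category of cubes -/

namespace Cube

/-- The product of the interval with a nondecreasing map between cubes. -/
def consMap {p q : ℕ} (f : CubeVertices p →o CubeVertices q) :
    CubeVertices (p + 1) →o CubeVertices (q + 1) where
  toFun x := Fin.cons (α := fun _ => Fin 2) (x 0) (f (Fin.tail x))
  monotone' x y h := by
    rw [Fin.cons_le_cons]
    exact ⟨h 0, f.monotone fun j => h j.succ⟩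

lemma isCubical_consMap {p q : ℕ} {f : CubeVertices p →o CubeVertices q} (h : IsCubical f) :
    IsCubical (consMap f) := by
  induction h with
  | id p =>
    convert IsCubical.id (p + 1) using 1
    exact OrderHom.ext _ _ (funext fun x => Fin.cons_self_tail x)
  | face i τ =>
    convert IsCubical.face i.succ τ using 1
    refine OrderHom.ext _ _ (funext fun x => ?_)
    change Fin.cons (α := fun _ => Fin 2) (x 0) (Fin.insertNth (α := fun _ => Fin 2) i τ
      (Fin.tail x)) = Fin.insertNth (α := fun _ => Fin 2) i.succ τ x
    rw [Fin.eq_insertNth_iff]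
    refine ⟨by simp, funext fun m => ?_⟩
    refine Fin.cases ?_ (fun m => ?_) m
    · simp [Fin.removeNth_apply]
    · simp [Fin.removeNth_apply, Fin.tail]
  | degeneracy i =>
    convert IsCubical.degeneracy i.succ using 1
    refine OrderHom.ext _ _ (funext fun x => funext fun m => ?_)
    refine Fin.cases ?_ (fun m => ?_) m
    · change x 0 = x (i.succ.succAbove 0)
      rw [Fin.succ_succAbove_zero]
    · change x (i.succAbove m).succ = x (i.succ.succAbove m.succ)
      rw [Fin.succ_succAbove_succ]
  | comp _ _ hg hf => exact IsCubical.comp hg hf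

/-- The product of the interval with a morphism of cubes. -/
def cons {p q : ℕ} (f : (⟨p⟩ : Cube) ⟶ ⟨q⟩) : (⟨p + 1⟩ : Cube) ⟶ ⟨q + 1⟩ :=
  (⟨consMap (Hom.map f), isCubical_consMap (Hom.isCubical f)⟩ : Hom ⟨p + 1⟩ ⟨q + 1⟩)

lemma comp_map_apply {a b c : Cube} (f : a ⟶ b) (g : b ⟶ c) (x : CubeVertices a.dim) :
    Hom.map (f ≫ g) x = Hom.map g (Hom.map f x) := rfl

lemma δ_map_apply {n : ℕ} (i : Fin (n + 1)) (τ : Fin 2) (x : CubeVertices n) :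
    Hom.map (δ i τ) x = Fin.insertNth (α := fun _ => Fin 2) i τ x := rfl

lemma ε_map_apply {n : ℕ} (i : Fin (n + 1)) (x : CubeVertices (n + 1)) (m : Fin n) :
    Hom.map (ε i) x m = x (i.succAbove m) := rfl

lemma cons_map_zero {p q : ℕ} (f : (⟨p⟩ : Cube) ⟶ ⟨q⟩) (x : CubeVertices (p + 1)) :
    Hom.map (cons f) x 0 = x 0 := rfl

lemma cons_map_succ {p q : ℕ} (f : (⟨p⟩ : Cube) ⟶ ⟨q⟩) (x : CubeVertices (p + 1)) (m : Fin q) :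
    Hom.map (cons f) x m.succ = Hom.map f (Fin.tail x) m := rfl

lemma δ_zero_map_zero {n : ℕ} (τ : Fin 2) (x : CubeVertices n) :
    Hom.map (δ (0 : Fin (n + 1)) τ) x 0 = τ := rfl

lemma δ_zero_map_succ {n : ℕ} (τ : Fin 2) (x : CubeVertices n) (m : Fin n) :
    Hom.map (δ (0 : Fin (n + 1)) τ) x m.succ = x m := by
  rw [δ_map_apply]
  simp

/-- The two ends of the prism `cons f` are copies of `f`. Both the homotopy formula and the
connection of vertices by edges come from this. -/
lemma δ_zero_comp_cons {p q : ℕ} (f : (⟨p⟩ : Cube) ⟶ ⟨q⟩) (τ : Fin 2) :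
    δ 0 τ ≫ cons f = f ≫ δ 0 τ := by
  refine hom_ext fun x => funext fun m => ?_
  refine Fin.cases rfl (fun m => ?_) m
  rw [comp_map_apply, comp_map_apply, cons_map_succ, δ_zero_map_succ]
  congr 2

lemma cons_comp_ε_zero {p q : ℕ} (f : (⟨p⟩ : Cube) ⟶ ⟨q⟩) : cons f ≫ ε 0 = ε 0 ≫ f := by
  refine hom_ext fun x => funext fun m => ?_
  rw [comp_map_apply, comp_map_apply, ε_map_apply, Fin.zero_succAbove, cons_map_succ]
  rfl

lemma cons_comp {p q r : ℕ} (f : (⟨p⟩ : Cube) ⟶ ⟨q⟩) (g : (⟨q⟩ : Cube) ⟶ ⟨r⟩) :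
    cons (f ≫ g) = cons f ≫ cons g := rfl

lemma cons_δ {n : ℕ} (i : Fin (n + 1)) (τ : Fin 2) : cons (δ i τ) = δ i.succ τ := by
  refine hom_ext fun x => ?_
  rw [δ_map_apply, Fin.eq_insertNth_iff]
  refine ⟨by rw [cons_map_succ, δ_map_apply, Fin.insertNth_apply_same], funext fun m => ?_⟩
  rw [Fin.removeNth_apply]
  refine Fin.cases ?_ (fun m => ?_) m
  · rw [Fin.succ_succAbove_zero, cons_map_zero]
  · rw [Fin.succ_succAbove_succ, cons_map_succ, δ_map_apply, Fin.insertNth_apply_succAbove]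
    rfl

lemma cons_ε {n : ℕ} (i : Fin (n + 1)) : cons (ε i) = ε i.succ := by
  refine hom_ext fun x => funext fun m => ?_
  refine Fin.cases ?_ (fun m => ?_) m
  · rw [cons_map_zero, ε_map_apply, Fin.succ_succAbove_zero]
  · rw [cons_map_succ, ε_map_apply, ε_map_apply, Fin.succ_succAbove_succ]
    rfl

lemma ε_comp_δ_map_apply {n : ℕ} (i : Fin (n + 1)) (τ : Fin 2) (x : CubeVertices (n + 1)) :
    Hom.map (ε i ≫ δ i τ) x = Function.update x i τ := by
  change Fin.insertNth (α := fun _ => Fin 2) i τ (Fin.removeNth (α := fun _ => Fin 2) i x) = _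
  rw [Fin.insertNth_removeNth]

/-- Both sides overwrite the coordinates `i` and `j` by `0`, in either order. -/
lemma ε_comp_δ_comm {n : ℕ} (i j : Fin (n + 1)) :
    (ε i ≫ δ i 0) ≫ ε j ≫ δ j 0 = (ε j ≫ δ j 0) ≫ ε i ≫ δ i 0 := by
  refine hom_ext fun x => ?_
  by_cases h : i = j
  · rw [h]
  · rw [comp_map_apply, comp_map_apply (ε j ≫ δ j 0), ε_comp_δ_map_apply, ε_comp_δ_map_apply,
      ε_comp_δ_map_apply, ε_comp_δ_map_apply]
    exact Function.update_comm h _ _ _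

/-- Each coordinate of a morphism of cubes is either constant or a coordinate of the argument,
and the coordinates of the argument occur at most once and in their order. -/
lemma exists_coordinates {p q : ℕ} {f : CubeVertices p →o CubeVertices q} (h : IsCubical f) :
    ∃ σ : Fin q → Fin 2 ⊕ Fin p, (∀ x b, f x b = Sum.elim id x (σ b)) ∧
      ∀ b b' i i', σ b = Sum.inr i → σ b' = Sum.inr i' → b < b' → i < i' := by
  induction h with
  | id p =>
    refine ⟨Sum.inr, fun _ _ => rfl, fun b b' i i' h h' hb => ?_⟩
    rw [Sum.inr.injEq] at h h'
    rwa [← h, ← h']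
  | @face n i τ =>
    refine ⟨Fin.insertNth (α := fun _ => Fin 2 ⊕ Fin n) i (Sum.inl τ) Sum.inr, fun x b => ?_, ?_⟩
    · change Fin.insertNth (α := fun _ => Fin 2) i τ x b = _
      refine Fin.succAboveCases i ?_ (fun b => ?_) b <;> simp
    · intro b b' j j'
      refine Fin.succAboveCases i (by simp) (fun b => ?_) b
      refine Fin.succAboveCases i (by simp) (fun b' => ?_) b'
      rw [Fin.insertNth_apply_succAbove, Fin.insertNth_apply_succAbove, Sum.inr.injEq,
        Sum.inr.injEq, Fin.succAbove_lt_succAbove_iff]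
      rintro rfl rfl h
      exact h
  | degeneracy i =>
    refine ⟨fun b => Sum.inr (i.succAbove b), fun _ _ => rfl, fun b b' j j' h h' hb => ?_⟩
    rw [Sum.inr.injEq] at h h'
    rw [← h, ← h']
    exact Fin.succAbove_lt_succAbove_iff.2 hb
  | comp _ _ hg hf =>
    obtain ⟨σ, hσ, hσ'⟩ := hg
    obtain ⟨ρ, hρ, hρ'⟩ := hf
    refine ⟨fun b => Sum.elim Sum.inl ρ (σ b), fun x b => ?_, fun b b' i i' h h' hb => ?_⟩
    · rw [OrderHom.comp_coe, Function.comp_apply, hσ]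
      dsimp only
      cases σ b with
      | inl τ => rfl
      | inr j => exact hρ x j
    · dsimp only at h h'
      cases hs : σ b with
      | inl τ => simp [hs] at h
      | inr j =>
        cases hs' : σ b' with
        | inl τ => simp [hs'] at h'
        | inr j' =>
          rw [hs] at h
          rw [hs'] at h'
          exact hρ' j j' i i' h h' (hσ' b b' j j' hs hs' hb)

/-- The cases are the possible first coordinates of `f`. A constant `τ` gives a face. The input `x
0` gives a prism, since by the order condition the other coordinates use later inputs. An input `x
i` with `i > 0` forces every coordinate to avoid `x 0`, so `f` factors through `ε 0`. -/
lemma eq_face_or_cons_or_degenerate {p q : ℕ} (f : (⟨p⟩ : Cube) ⟶ ⟨q + 1⟩) :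
    (∃ (τ : Fin 2) (g : (⟨p⟩ : Cube) ⟶ ⟨q⟩), f = g ≫ δ 0 τ) ∨
    ∃ (p' : ℕ) (hp : p = p' + 1),
      (∃ g : (⟨p'⟩ : Cube) ⟶ ⟨q⟩, f = eqToHom (by rw [hp]) ≫ cons g) ∨
      ∃ g : (⟨p'⟩ : Cube) ⟶ ⟨q + 1⟩, f = eqToHom (by rw [hp]) ≫ ε 0 ≫ g := by
  obtain ⟨σ, hσ, hσ'⟩ := exists_coordinates (Hom.isCubical f)
  cases h : σ 0 with
  | inl τ =>
    refine Or.inl ⟨τ, f ≫ ε 0, hom_ext fun x => funext fun m => ?_⟩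
    refine Fin.cases ?_ (fun m => ?_) m
    · rw [comp_map_apply, δ_zero_map_zero, hσ, h]
      rfl
    · rw [comp_map_apply, δ_zero_map_succ]
      rfl
  | inr i =>
    cases p with
    | zero => exact i.elim0
    | succ p =>
      refine Or.inr ⟨p, rfl, ?_⟩
      -- A coordinate that does not read the input `0` is unchanged when this input is set to `0`.
      have key : ∀ (b : Fin (q + 1)) (x : CubeVertices (p + 1)), σ b ≠ Sum.inr 0 →
          Hom.map f (Hom.map (ε 0 ≫ δ 0 0) x) b = Hom.map f x b := fun b x hb => by
        rw [hσ, hσ]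
        cases hs : σ b with
        | inl τ => rfl
        | inr j =>
          rw [ε_comp_δ_map_apply]
          exact Function.update_of_ne (fun hj => hb (by rw [hs, hj])) _ _
      simp only [eqToHom_refl, Category.id_comp]
      by_cases hi : i = 0
      · refine Or.inl ⟨δ 0 0 ≫ f ≫ ε 0, hom_ext fun x => funext fun m => ?_⟩
        refine Fin.cases ?_ (fun m => ?_) m
        · rw [cons_map_zero, hσ, h, hi]
          rfl
        · refine (key m.succ x fun hm => ?_).symm
          exact absurd (hσ' 0 m.succ i 0 h hm (Fin.succ_pos m)) (Fin.not_lt_zero i)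
      · refine Or.inr ⟨δ 0 0 ≫ f, hom_ext fun x => funext fun m => (key m x fun hm => ?_).symm⟩
        refine Fin.cases (fun hm => hi ?_) (fun m hm => ?_) m hm
        · rw [h, Sum.inr.injEq] at hm
          exact hm
        · exact absurd (hσ' 0 m.succ i 0 h hm (Fin.succ_pos m)) (Fin.not_lt_zero i)

end Cube

/-! ### Chains, degenerate chains and contractions -/

namespace CubicalAbGroup

section Basic

variable {F G : CubicalAbGroup.{u}}

lemma map_comp_apply {p q r : ℕ} (f : (⟨p⟩ : Cube) ⟶ ⟨q⟩) (g : (⟨q⟩ : Cube) ⟶ ⟨r⟩)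
    (x : F.chains r) : (F.map f.op).hom ((F.map g.op).hom x) = (F.map (f ≫ g).op).hom x := by
  rw [op_comp, F.map_comp]
  rfl

lemma app_map_apply (φ : F ⟶ G) {p q : ℕ} (f : (⟨p⟩ : Cube) ⟶ ⟨q⟩) (x : F.chains q) :
    (φ.app (op ⟨p⟩)).hom ((F.map f.op).hom x) = (G.map f.op).hom ((φ.app (op ⟨q⟩)).hom x) :=
  congrArg (fun ψ => ψ.hom x) (φ.naturality f.op)

lemma d_apply (n : ℕ) (x : F.chains (n + 1)) :
    (F.d n).hom x = ∑ i : Fin (n + 1), (-1 : ℤ) ^ ((i : ℕ) + 1) •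
      ((F.map (Cube.δ i 0).op).hom x - (F.map (Cube.δ i 1).op).hom x) := by
  let ev : (F.chains (n + 1) ⟶ F.chains n) →+ F.chains n :=
    { toFun := fun f => f.hom x
      map_zero' := rfl
      map_add' := fun _ _ => rfl }
  refine (map_sum ev _ _).trans (Finset.sum_congr rfl fun i _ => ?_)
  exact (map_zsmul ev _ _).trans (congrArg _ (map_sub ev _ _))

lemma app_d_apply (φ : F ⟶ G) (n : ℕ) (x : F.chains (n + 1)) :
    (φ.app (op ⟨n⟩)).hom ((F.d n).hom x) = (G.d n).hom ((φ.app (op ⟨n + 1⟩)).hom x) := by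
  rw [d_apply, d_apply, map_sum]
  refine Finset.sum_congr rfl fun i _ => ?_
  rw [map_zsmul, map_sub, app_map_apply, app_map_apply]

lemma map_ε_mem_degenerate {n : ℕ} (i : Fin (n + 1)) (x : F.chains n) :
    (F.map (Cube.ε i).op).hom x ∈ F.degenerate (n + 1) :=
  AddSubgroup.mem_iSup_of_mem i ⟨x, rfl⟩

/-- The degree stays a variable, with `n = m + 1` as a hypothesis, so that degree `0`, where there
are no degenerate chains except `0`, needs no separate treatment by the user. -/
lemma apply_mem_of_mem_degenerate {n : ℕ} {A : Type*} [AddCommGroup A]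
    (φ : F.chains n →+ A) (B : AddSubgroup A)
    (h : ∀ (m : ℕ) (hm : n = m + 1) (i : Fin (m + 1)) (x : F.chains m),
      φ ((F.map (eqToHom (by rw [hm]) ≫ Cube.ε i).op).hom x) ∈ B)
    {x : F.chains n} (hx : x ∈ F.degenerate n) : φ x ∈ B := by
  suffices F.degenerate n ≤ B.comap φ from this hx
  cases n with
  | zero => exact bot_le
  | succ n =>
    refine iSup_le fun i => ?_
    rintro _ ⟨x, rfl⟩
    simpa using h n rfl i x

lemma app_mem_degenerate (φ : F ⟶ G) {n : ℕ} {x : F.chains n} (hx : x ∈ F.degenerate n) :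
    (φ.app (op ⟨n⟩)).hom x ∈ G.degenerate n := by
  refine apply_mem_of_mem_degenerate (φ.app (op ⟨n⟩)).hom (G.degenerate n) (fun m hm i y => ?_) hx
  subst hm
  rw [eqToHom_refl, Category.id_comp, app_map_apply]
  exact map_ε_mem_degenerate i _

lemma d_mem_degenerate {n : ℕ} {x : F.chains (n + 1)} (hx : x ∈ F.degenerate (n + 1)) :
    (F.d n).hom x ∈ F.degenerate n :=
  F.degenerate_le_comap_d n hx

/-- A contraction of the normalized complex in positive degrees. -/
def HasContraction (F : CubicalAbGroup.{u}) : Prop :=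
  ∃ h : ∀ n, F.chains n →+ F.chains (n + 1),
    (∀ n, ∀ x ∈ F.degenerate n, h n x ∈ F.degenerate (n + 1)) ∧
    ∀ n x, (F.d (n + 1)).hom (h (n + 1) x) + h n ((F.d n).hom x) - x ∈ F.degenerate (n + 1)

end Basic

/-! ### Free cubical Abelian groups -/

/-- The free cubical Abelian group on a family of cubes. -/
def free (J : Type u) (dim : J → ℕ) : CubicalAbGroup.{u} where
  obj X := AddCommGrpCat.of (FreeAbelianGroup (Σ j, X.unop ⟶ (⟨dim j⟩ : Cube)))
  map f := AddCommGrpCat.ofHom (FreeAbelianGroup.map fun g => ⟨g.1, f.unop ≫ g.2⟩)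
  map_id X := by
    refine AddCommGrpCat.hom_ext (FreeAbelianGroup.lift_ext _ _ fun g => ?_)
    refine (FreeAbelianGroup.map_of_apply g).trans ?_
    rw [unop_id, Category.id_comp]
    rfl
  map_comp f g := by
    refine AddCommGrpCat.hom_ext (FreeAbelianGroup.lift_ext _ _ fun k => ?_)
    refine (FreeAbelianGroup.map_of_apply k).trans ?_
    rw [unop_comp, Category.assoc]
    rfl

namespace free

variable {J : Type u} {dim : J → ℕ}

/-- The generators of the free cubical Abelian group. -/
def gen {n : ℕ} (j : J) (f : (⟨n⟩ : Cube) ⟶ ⟨dim j⟩) : (free J dim).chains n :=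
  FreeAbelianGroup.of (⟨j, f⟩ : Σ j, (⟨n⟩ : Cube) ⟶ (⟨dim j⟩ : Cube))

lemma map_gen {p q : ℕ} (g : (⟨p⟩ : Cube) ⟶ ⟨q⟩) (j : J) (f : (⟨q⟩ : Cube) ⟶ ⟨dim j⟩) :
    ((free J dim).map g.op).hom (gen j f) = gen j (g ≫ f) :=
  FreeAbelianGroup.map_of_apply _

/-- The homomorphism on chains with the given values on generators. -/
def lift {n : ℕ} {A : Type*} [AddCommGroup A] (φ : ∀ j : J, ((⟨n⟩ : Cube) ⟶ ⟨dim j⟩) → A) :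
    (free J dim).chains n →+ A :=
  FreeAbelianGroup.lift fun g => φ g.1 g.2

lemma lift_gen {n : ℕ} {A : Type*} [AddCommGroup A]
    (φ : ∀ j : J, ((⟨n⟩ : Cube) ⟶ ⟨dim j⟩) → A) (j : J) (f : (⟨n⟩ : Cube) ⟶ ⟨dim j⟩) :
    lift φ (gen j f) = φ j f :=
  FreeAbelianGroup.lift_apply_of _ _

lemma apply_mem {n : ℕ} {A : Type*} [AddCommGroup A] (φ : (free J dim).chains n →+ A)
    (B : AddSubgroup A) (h : ∀ (j : J) (f : (⟨n⟩ : Cube) ⟶ ⟨dim j⟩), φ (gen j f) ∈ B)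
    (x : (free J dim).chains n) : φ x ∈ B := by
  refine FreeAbelianGroup.induction_on (motive := fun x => φ x ∈ B) x ?_ (fun g => h g.1 g.2)
    (fun g hg => ?_) fun x y hx hy => ?_
  · exact (map_zero φ).symm ▸ zero_mem B
  · exact (map_neg φ _).symm ▸ neg_mem hg
  · exact (map_add φ _ _).symm ▸ add_mem hx hy

lemma hom_ext {n : ℕ} {A : Type*} [AddCommGroup A] {φ ψ : (free J dim).chains n →+ A}
    (h : ∀ (j : J) (f : (⟨n⟩ : Cube) ⟶ ⟨dim j⟩), φ (gen j f) = ψ (gen j f)) : φ = ψ :=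
  FreeAbelianGroup.lift_ext _ _ fun g => h g.1 g.2

/-- The morphism out of a free cubical Abelian group with the given values on generators. -/
def desc {F : CubicalAbGroup.{u}} (x : ∀ j, F.chains (dim j)) : free J dim ⟶ F where
  app X := AddCommGrpCat.ofHom (lift (n := X.unop.dim) fun j f => (F.map f.op).hom (x j))
  naturality X Y f := by
    refine AddCommGrpCat.hom_ext (hom_ext (n := X.unop.dim) fun j g => ?_)
    refine (congrArg (lift (n := Y.unop.dim) fun j f => (F.map f.op).hom (x j))
      (map_gen (p := Y.unop.dim) (q := X.unop.dim) f.unop j g)).trans ?_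
    refine (lift_gen _ _ _).trans ?_
    refine (map_comp_apply _ _ _).symm.trans ?_
    exact congrArg (F.map f).hom
      (lift_gen (n := X.unop.dim) (fun j f => (F.map f.op).hom (x j)) j g).symm

lemma desc_gen {F : CubicalAbGroup.{u}} (x : ∀ j, F.chains (dim j)) {n : ℕ} (j : J)
    (f : (⟨n⟩ : Cube) ⟶ ⟨dim j⟩) :
    ((desc x).app (op ⟨n⟩)).hom (gen j f) = (F.map f.op).hom (x j) :=
  lift_gen _ _ _

lemma d_gen {n : ℕ} (j : J) (f : (⟨n + 1⟩ : Cube) ⟶ ⟨dim j⟩) :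
    ((free J dim).d n).hom (gen j f) = ∑ i : Fin (n + 1), (-1 : ℤ) ^ ((i : ℕ) + 1) •
      (gen j (Cube.δ i 0 ≫ f) - gen j (Cube.δ i 1 ≫ f)) := by
  simp only [d_apply, map_gen]

lemma gen_ε_mem_degenerate {n : ℕ} (i : Fin (n + 1)) (j : J) (f : (⟨n⟩ : Cube) ⟶ ⟨dim j⟩) :
    gen j (Cube.ε i ≫ f) ∈ (free J dim).degenerate (n + 1) := by
  rw [← map_gen]
  exact map_ε_mem_degenerate _ _

lemma apply_mem_of_mem_degenerate {A : Type*} [AddCommGroup A] {n : ℕ}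
    (φ : (free J dim).chains n →+ A) (B : AddSubgroup A)
    (h : ∀ (m : ℕ) (hm : n = m + 1) (i : Fin (m + 1)) (j : J) (f : (⟨m⟩ : Cube) ⟶ ⟨dim j⟩),
      φ (gen j ((eqToHom (by rw [hm]) ≫ Cube.ε i) ≫ f)) ∈ B)
    {x : (free J dim).chains n} (hx : x ∈ (free J dim).degenerate n) : φ x ∈ B := by
  refine CubicalAbGroup.apply_mem_of_mem_degenerate φ B (fun m hm i x => ?_) hx
  refine apply_mem (φ.comp ((free J dim).map (eqToHom _ ≫ Cube.ε i).op).hom) B (fun j f => ?_) x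
  rw [AddMonoidHom.comp_apply, map_gen]
  exact h m hm i j f

end free

/-! ### Contraction of the standard cubes -/

/-- The cubical Abelian group freely generated by a cube. -/
abbrev standardCube (m : ℕ) : CubicalAbGroup.{u} := free PUnit.{u + 1} fun _ => m

namespace standardCube

open free

variable {m : ℕ}

/-- The generators of the cubical Abelian group freely generated by a cube. -/
def cell {n : ℕ} (f : (⟨n⟩ : Cube) ⟶ ⟨m⟩) : (standardCube.{u} m).chains n :=
  gen (dim := fun _ => m) PUnit.unit f

lemma map_cell {p q : ℕ} (g : (⟨p⟩ : Cube) ⟶ ⟨q⟩) (f : (⟨q⟩ : Cube) ⟶ ⟨m⟩) :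
    ((standardCube.{u} m).map g.op).hom (cell f) = cell (g ≫ f) :=
  map_gen (dim := fun _ => m) g PUnit.unit f

lemma d_cell {n : ℕ} (f : (⟨n + 1⟩ : Cube) ⟶ ⟨m⟩) :
    ((standardCube.{u} m).d n).hom (cell f) = ∑ i : Fin (n + 1), (-1 : ℤ) ^ ((i : ℕ) + 1) •
      (cell (Cube.δ i 0 ≫ f) - cell (Cube.δ i 1 ≫ f)) :=
  d_gen (dim := fun _ => m) PUnit.unit f

lemma desc_cell {F : CubicalAbGroup.{u}} (x : F.chains m) {n : ℕ} (f : (⟨n⟩ : Cube) ⟶ ⟨m⟩) :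
    ((desc (dim := fun _ => m) fun _ => x).app (op ⟨n⟩)).hom (cell f) = (F.map f.op).hom x :=
  desc_gen (dim := fun _ => m) _ PUnit.unit f

lemma cell_ε_mem_degenerate {n : ℕ} (i : Fin (n + 1)) (f : (⟨n⟩ : Cube) ⟶ ⟨m⟩) :
    cell (Cube.ε i ≫ f) ∈ (standardCube.{u} m).degenerate (n + 1) :=
  gen_ε_mem_degenerate (dim := fun _ => m) i PUnit.unit f

lemma apply_mem {n : ℕ} {A : Type*} [AddCommGroup A] (φ : (standardCube.{u} m).chains n →+ A)
    (B : AddSubgroup A) (h : ∀ f : (⟨n⟩ : Cube) ⟶ ⟨m⟩, φ (cell f) ∈ B)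
    (x : (standardCube.{u} m).chains n) : φ x ∈ B :=
  free.apply_mem φ B (fun _ f => h f) x

open Classical in
/-- The homotopy that fills in the first coordinate of the maps where it is constantly `1`. -/
noncomputable def firstHomotopy (n : ℕ) :
    (standardCube.{u} (m + 1)).chains n →+ (standardCube.{u} (m + 1)).chains (n + 1) :=
  lift (dim := fun _ => m + 1) fun _ f => if f = (f ≫ Cube.ε 0) ≫ Cube.δ 0 1 then cell (Cube.cons (f ≫ Cube.ε 0)) else 0

lemma firstHomotopy_comp_δ_one {n : ℕ} (g : (⟨n⟩ : Cube) ⟶ ⟨m⟩) :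
    firstHomotopy n (cell (g ≫ Cube.δ 0 1)) = cell (Cube.cons g) := by
  have h : (g ≫ Cube.δ 0 1) ≫ Cube.ε 0 = g := by
    rw [Category.assoc, Cube.δ_comp_ε_self, Category.comp_id]
  rw [firstHomotopy, cell, lift_gen, h, if_pos rfl]

/-- One vertex with first coordinate `0` is enough, since the homotopy is nonzero only on maps whose
first coordinate is constantly `1`. -/
lemma firstHomotopy_eq_zero {n : ℕ} (f : (⟨n⟩ : Cube) ⟶ ⟨m + 1⟩)
    (x : CubeVertices n) (hx : Cube.Hom.map f x 0 = 0) :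
    firstHomotopy n (cell f) = 0 := by
  rw [firstHomotopy, cell, lift_gen, if_neg]
  intro h
  rw [h, Cube.comp_map_apply, Cube.δ_zero_map_zero] at hx
  exact one_ne_zero hx

/-- Since `ε i` is split by `δ i 0`, precomposing with it does not affect whether the first
coordinate is constantly `1`. The index becomes `i.succ` because the homotopy adds a coordinate in
front. -/
lemma firstHomotopy_ε_comp {n : ℕ} (i : Fin (n + 1)) (f : (⟨n⟩ : Cube) ⟶ ⟨m + 1⟩) :
    firstHomotopy (n + 1) (cell (Cube.ε i ≫ f)) =
      ((standardCube.{u} (m + 1)).map (Cube.ε i.succ).op).hom (firstHomotopy n (cell f)) := by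
  have h : Cube.ε i ≫ f = ((Cube.ε i ≫ f) ≫ Cube.ε 0) ≫ Cube.δ 0 1 ↔
      f = (f ≫ Cube.ε 0) ≫ Cube.δ 0 1 := by
    refine ⟨fun h => ?_, fun h => ?_⟩
    · simpa only [← Category.assoc, Cube.δ_comp_ε_self, Category.id_comp] using
        congrArg (fun g => Cube.δ i 0 ≫ g) h
    · simpa only [Category.assoc] using congrArg (fun g => Cube.ε i ≫ g) h
  rw [firstHomotopy, firstHomotopy, cell, cell, lift_gen, lift_gen]
  by_cases hf : f = (f ≫ Cube.ε 0) ≫ Cube.δ 0 1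
  · rw [if_pos hf, if_pos (h.2 hf), map_cell, Category.assoc, Cube.cons_comp, Cube.cons_ε]
  · rw [if_neg hf, if_neg (mt h.1 hf), map_zero]

lemma firstHomotopy_mem_degenerate {n : ℕ} {x : (standardCube.{u} (m + 1)).chains n}
    (hx : x ∈ (standardCube.{u} (m + 1)).degenerate n) :
    firstHomotopy n x ∈ (standardCube.{u} (m + 1)).degenerate (n + 1) := by
  refine free.apply_mem_of_mem_degenerate (firstHomotopy n) _ (fun p hp i _ f => ?_) hx
  subst hp
  rw [eqToHom_refl, Category.id_comp]
  refine (congrArg (· ∈ _) (firstHomotopy_ε_comp i f)).mpr ?_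
  exact map_ε_mem_degenerate _ _

/-- Modulo degenerate chains, this is a homotopy from the identity to the projection onto the face
where the first coordinate is `0`. -/
lemma d_firstHomotopy (n : ℕ) (f : (⟨n + 1⟩ : Cube) ⟶ ⟨m + 1⟩) :
    ((standardCube.{u} (m + 1)).d (n + 1)).hom (firstHomotopy (n + 1) (cell f)) +
      firstHomotopy n (((standardCube.{u} (m + 1)).d n).hom (cell f)) -
      (cell f - cell ((f ≫ Cube.ε 0) ≫ Cube.δ 0 0)) ∈
      (standardCube.{u} (m + 1)).degenerate (n + 1) := by
  rcases Cube.eq_face_or_cons_or_degenerate f with ⟨τ, g, rfl⟩ | ⟨p, hp, ⟨g, rfl⟩ | ⟨g, rfl⟩⟩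
  · have hg : (g ≫ Cube.δ 0 τ) ≫ Cube.ε 0 = g := by
      rw [Category.assoc, Cube.δ_comp_ε_self, Category.comp_id]
    have hτ : τ = 0 ∨ τ = 1 := by lia
    refine (congrArg (· ∈ _) ?_).mpr (AddSubgroup.zero_mem _)
    rw [hg]
    rcases hτ with rfl | rfl
    -- First coordinate constantly `0`: the homotopy vanishes on `f` and on all its faces.
    · rw [firstHomotopy_eq_zero _ 0 rfl, map_zero, sub_self, sub_zero, zero_add, d_cell, map_sum]
      refine Finset.sum_eq_zero fun i _ => ?_
      rw [map_zsmul, map_sub, firstHomotopy_eq_zero _ 0 rfl, firstHomotopy_eq_zero _ 0 rfl,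
        sub_self, smul_zero]
    -- First coordinate constantly `1`: the ends of the prism give the right-hand side, and its
    -- remaining faces cancel against the prisms over the faces of `g`, the shift of index reversing
    -- the sign.
    · rw [firstHomotopy_comp_δ_one, d_cell, d_cell, Fin.sum_univ_succ, map_sum,
        Cube.δ_zero_comp_cons, Cube.δ_zero_comp_cons, add_assoc, ← Finset.sum_add_distrib,
        Finset.sum_eq_zero, Fin.val_zero, zero_add, pow_one, neg_smul, one_smul]
      · abel
      · intro i _
        rw [map_zsmul, map_sub, ← Category.assoc, ← Category.assoc, firstHomotopy_comp_δ_one,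
          firstHomotopy_comp_δ_one, Cube.cons_comp, Cube.cons_comp, Cube.cons_δ, Cube.cons_δ,
          Fin.val_succ, pow_succ _ ((i : ℕ) + 1), mul_neg_one, neg_smul, neg_add_cancel]
  · obtain rfl : n = p := by simpa using hp
    rw [eqToHom_refl, Category.id_comp]
    -- Among the faces of the prism only the end at `1` has first coordinate constantly `1`; it
    -- occurs in the differential with sign `+`, and the homotopy sends it back to the prism.
    have hd : firstHomotopy n (((standardCube.{u} (m + 1)).d n).hom (cell (Cube.cons g))) =
        cell (Cube.cons g) := by
      rw [d_cell, map_sum, Fin.sum_univ_succ, Finset.sum_eq_zero, add_zero, map_zsmul, map_sub,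
        Cube.δ_zero_comp_cons, Cube.δ_zero_comp_cons, firstHomotopy_eq_zero (g ≫ _) 0 rfl,
        firstHomotopy_comp_δ_one, Fin.val_zero, zero_add, pow_one, neg_smul, one_smul, zero_sub,
        neg_neg]
      · intro i _
        have hi (τ : Fin 2) : firstHomotopy.{u} n (cell (Cube.δ i.succ τ ≫ Cube.cons g)) = 0 := by
          cases n with
          | zero => exact i.elim0
          | succ n =>
            rw [← Cube.cons_δ, ← Cube.cons_comp]
            exact firstHomotopy_eq_zero _ 0 rfl
        rw [map_zsmul, map_sub, hi, hi, sub_self, smul_zero]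
    rw [hd, firstHomotopy_eq_zero _ 0 rfl, map_zero, zero_add, sub_sub_cancel,
      Cube.cons_comp_ε_zero, Category.assoc]
    exact cell_ε_mem_degenerate _ _
  · obtain rfl : n = p := by simpa using hp
    rw [eqToHom_refl, Category.id_comp]
    have h₀ := cell_ε_mem_degenerate.{u} 0 g
    refine sub_mem (add_mem ?_ ?_) (sub_mem h₀ ?_)
    · exact d_mem_degenerate (firstHomotopy_mem_degenerate h₀)
    · exact firstHomotopy_mem_degenerate (d_mem_degenerate h₀)
    · rw [Category.assoc, Category.assoc]
      exact cell_ε_mem_degenerate _ _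

/-- With `ι` the inclusion of the face at `0` and `π` the projection along the first coordinate,
`firstHomotopy` connects the identity with `ι π`, and `ι h π` contracts `ι π` when `h` contracts the
smaller cube; their sum contracts the larger one. -/
lemma hasContraction (m : ℕ) : HasContraction (standardCube.{u} m) := by
  induction m with
  | zero =>
    refine ⟨fun n => 0, fun n x _ => AddSubgroup.zero_mem _, fun n x => ?_⟩
    rw [AddMonoidHom.zero_apply, AddMonoidHom.zero_apply, map_zero, zero_add, zero_sub]
    refine neg_mem (apply_mem (AddMonoidHom.id _) _ (fun f => ?_) x)
    -- `𝕀⁰` is a point, so every cell of positive dimension is degenerate.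
    have hf : f = Cube.ε 0 ≫ Cube.δ 0 0 ≫ f := Cube.hom_ext fun x => Subsingleton.elim _ _
    rw [hf]
    exact cell_ε_mem_degenerate _ _
  | succ m ih =>
    obtain ⟨h, hD, hd⟩ := ih
    let ι : standardCube.{u} m ⟶ standardCube (m + 1) := desc fun _ => cell (Cube.δ 0 0)
    let π : standardCube.{u} (m + 1) ⟶ standardCube m := desc fun _ => cell (Cube.ε 0)
    refine ⟨fun n => firstHomotopy n +
      (ι.app _).hom.comp ((h n).comp (π.app (op ⟨n⟩)).hom), fun n x hx => ?_, fun n x => ?_⟩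
    · exact add_mem (firstHomotopy_mem_degenerate hx)
        (app_mem_degenerate ι (hD n _ (app_mem_degenerate π hx)))
    · let φ := ((standardCube.{u} (m + 1)).d (n + 1)).hom.comp (firstHomotopy (n + 1)) +
        (firstHomotopy n).comp ((standardCube.{u} (m + 1)).d n).hom -
        (AddMonoidHom.id _ - (ι.app _).hom.comp (π.app (op ⟨n + 1⟩)).hom)
      have h₁ : φ x ∈ (standardCube.{u} (m + 1)).degenerate (n + 1) := by
        refine apply_mem φ _ (fun f => ?_) x
        have hf : (ι.app _).hom ((π.app (op ⟨n + 1⟩)).hom (cell f)) =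
            cell ((f ≫ Cube.ε 0) ≫ Cube.δ 0 0) := by
          rw [desc_cell, map_cell, desc_cell, map_cell]
        have h := d_firstHomotopy n f
        rwa [← hf] at h
      have h₂ := app_mem_degenerate ι (hd n ((π.app _).hom x))
      convert add_mem h₁ h₂ using 1
      rw [map_sub, map_add, app_d_apply, ← app_d_apply π]
      simp only [AddMonoidHom.add_apply, AddMonoidHom.comp_apply, map_add]
      change _ = _ + _ - (x - (ι.app _).hom ((π.app (op ⟨n + 1⟩)).hom x)) + _
      simp only [AddMonoidHom.comp_apply]
      abel

end standardCube

/-! ### Acyclicity of free and projective cubical groups -/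

/-- Each generator spans the image of a standard cube under `ι j`; the contractions chosen on these
cubes together define one on the generators. -/
lemma free.hasContraction (J : Type u) (dim : J → ℕ) : HasContraction (free J dim) := by
  choose h hD hd using fun m => standardCube.hasContraction.{u} m
  let ι (j : J) : standardCube.{u} (dim j) ⟶ free J dim := desc fun _ => gen j (𝟙 _)
  have hι (j : J) {n : ℕ} (f : (⟨n⟩ : Cube) ⟶ ⟨dim j⟩) (a : PUnit) :
      ((ι j).app (op ⟨n⟩)).hom (gen a f) = gen j f := by
    rw [desc_gen, map_gen, Category.comp_id]
  let H (n : ℕ) : (free J dim).chains n →+ (free J dim).chains (n + 1) :=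
    lift fun j f => ((ι j).app _).hom (h (dim j) n (gen PUnit.unit f))
  have hH (j : J) (n : ℕ) (x : (standardCube.{u} (dim j)).chains n) :
      H n (((ι j).app _).hom x) = ((ι j).app _).hom (h (dim j) n x) := by
    refine DFunLike.congr_fun (f := (H n).comp ((ι j).app _).hom)
      (g := ((ι j).app _).hom.comp (h (dim j) n)) (free.hom_ext fun a f => ?_) x
    rw [AddMonoidHom.comp_apply, AddMonoidHom.comp_apply, hι, lift_gen]
  refine ⟨H, fun n x hx => ?_, fun n x => ?_⟩
  · refine free.apply_mem_of_mem_degenerate (H n) _ (fun p hp i j f => ?_) hx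
    subst hp
    rw [eqToHom_refl, Category.id_comp, ← hι j _ PUnit.unit, hH]
    exact app_mem_degenerate _ (hD _ _ _ (gen_ε_mem_degenerate _ _ _))
  · refine apply_mem (((free J dim).d (n + 1)).hom.comp (H (n + 1)) +
      (H n).comp ((free J dim).d n).hom - AddMonoidHom.id _) _ (fun j f => ?_) x
    change ((free J dim).d (n + 1)).hom (H (n + 1) (gen j f)) +
      H n (((free J dim).d n).hom (gen j f)) - gen j f ∈ _
    have := app_mem_degenerate (ι j) (hd (dim j) n (gen PUnit.unit f))
    rwa [map_sub, map_add, app_d_apply, ← hH, ← hH, app_d_apply, hι] at this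

/-- The cycles of the normalized complex of a projective cubical Abelian group are boundaries. -/
lemma exists_d_sub_mem_degenerate (P : CubicalAbGroup.{u}) [Projective P] (n : ℕ)
    (z : P.chains (n + 1)) (hz : (P.d n).hom z ∈ P.degenerate n) :
    ∃ w : P.chains (n + 2), (P.d (n + 1)).hom w - z ∈ P.degenerate (n + 1) := by
  -- `P` is covered by the free group on all of its elements and, being projective, is a retract of
  -- it; the contraction of `Q` then yields `w = π h s z`.
  let Q := free (Σ m, P.chains m) Sigma.fst
  let π : Q ⟶ P := free.desc Sigma.snd
  have hπ : Epi π := by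
    rw [NatTrans.epi_iff_epi_app]
    intro X
    rw [AddCommGrpCat.epi_iff_surjective]
    intro x
    refine ⟨free.gen ⟨X.unop.dim, x⟩ (𝟙 _), (free.desc_gen _ _ _).trans ?_⟩
    exact congrArg (fun k => k.hom x) (P.map_id X)
  let s : P ⟶ Q := Projective.factorThru (𝟙 P) π
  have hs (m : ℕ) (x : P.chains m) : (π.app _).hom ((s.app _).hom x) = x :=
    congrArg (fun k : P ⟶ P => (k.app (op ⟨m⟩)).hom x) (Projective.factorThru_comp (𝟙 P) π)
  obtain ⟨h, hD, hd⟩ := free.hasContraction (Σ m, P.chains m) Sigma.fst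
  refine ⟨(π.app _).hom (h _ ((s.app _).hom z)), ?_⟩
  have h₁ := app_mem_degenerate π (hd n ((s.app _).hom z))
  have h₂ := app_mem_degenerate π (hD _ _ (app_mem_degenerate s hz))
  rw [map_sub, map_add, hs, app_d_apply] at h₁
  rw [app_d_apply] at h₂
  convert sub_mem h₁ h₂ using 1
  abel

end CubicalAbGroup

/-! ### Splitting off the degenerate chains; exactness of normalization -/

namespace CubicalAbGroup

/-- The endomorphism of the chains that sets the coordinate `i` to `0`. -/
def setZero (F : CubicalAbGroup.{u}) {n : ℕ} (i : Fin (n + 1)) :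
    F.chains (n + 1) →+ F.chains (n + 1) :=
  (F.map (Cube.ε i ≫ Cube.δ i 0).op).hom

/-- The composition of the endomorphisms `x ↦ x - setZero i x` over the positions `i` in a list. -/
def reduceAt (F : CubicalAbGroup.{u}) {n : ℕ} :
    List (Fin (n + 1)) → (F.chains (n + 1) →+ F.chains (n + 1))
  | [] => AddMonoidHom.id _
  | i :: l => (AddMonoidHom.id _ - F.setZero i).comp (F.reduceAt l)

/-- The natural projection of the chains along the degenerate chains. -/
def reduce (F : CubicalAbGroup.{u}) : ∀ n : ℕ, F.chains n →+ F.chains n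
  | 0 => AddMonoidHom.id _
  | n + 1 => F.reduceAt (List.finRange (n + 1))

section

variable {F G : CubicalAbGroup.{u}}

lemma reduceAt_cons_apply {n : ℕ} (i : Fin (n + 1)) (l : List (Fin (n + 1)))
    (x : F.chains (n + 1)) :
    F.reduceAt (i :: l) x = F.reduceAt l x - F.setZero i (F.reduceAt l x) := rfl

lemma setZero_setZero_comm {n : ℕ} (i j : Fin (n + 1)) (x : F.chains (n + 1)) :
    F.setZero i (F.setZero j x) = F.setZero j (F.setZero i x) := by
  simp only [setZero, map_comp_apply]
  rw [Cube.ε_comp_δ_comm]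

lemma setZero_map_ε {n : ℕ} (i : Fin (n + 1)) (x : F.chains n) :
    F.setZero i ((F.map (Cube.ε i).op).hom x) = (F.map (Cube.ε i).op).hom x := by
  rw [setZero, map_comp_apply, Category.assoc, Cube.δ_comp_ε_self, Category.comp_id]

lemma setZero_mem_degenerate {n : ℕ} (i : Fin (n + 1)) (x : F.chains (n + 1)) :
    F.setZero i x ∈ F.degenerate (n + 1) := by
  rw [setZero, ← map_comp_apply]
  exact map_ε_mem_degenerate _ _

lemma setZero_reduceAt {n : ℕ} (i : Fin (n + 1)) (l : List (Fin (n + 1)))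
    (x : F.chains (n + 1)) :
    F.setZero i (F.reduceAt l x) = F.reduceAt l (F.setZero i x) := by
  induction l with
  | nil => rfl
  | cons j l ih =>
    rw [reduceAt_cons_apply, reduceAt_cons_apply, map_sub, setZero_setZero_comm, ih]

/-- The factor `1 - setZero i` kills the image of `ε i`, and it can be moved past the other factors
because they all commute. -/
lemma reduceAt_map_ε {n : ℕ} (i : Fin (n + 1)) (l : List (Fin (n + 1))) (hi : i ∈ l)
    (x : F.chains n) : F.reduceAt l ((F.map (Cube.ε i).op).hom x) = 0 := by
  induction l with
  | nil => simp at hi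
  | cons j l ih =>
    rw [reduceAt_cons_apply]
    rcases List.mem_cons.1 hi with rfl | h
    · rw [setZero_reduceAt, setZero_map_ε, sub_self]
    · rw [ih h, map_zero, sub_self]

lemma reduceAt_sub_mem_degenerate {n : ℕ} (l : List (Fin (n + 1))) (x : F.chains (n + 1)) :
    F.reduceAt l x - x ∈ F.degenerate (n + 1) := by
  induction l with
  | nil => exact (sub_self x).symm ▸ zero_mem _
  | cons j l ih =>
    rw [reduceAt_cons_apply, sub_right_comm]
    exact sub_mem ih (setZero_mem_degenerate _ _)

lemma app_reduceAt (φ : F ⟶ G) {n : ℕ} (l : List (Fin (n + 1))) (x : F.chains (n + 1)) :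
    (φ.app (op ⟨n + 1⟩)).hom (F.reduceAt l x) =
      G.reduceAt l ((φ.app (op ⟨n + 1⟩)).hom x) := by
  induction l with
  | nil => rfl
  | cons j l ih =>
    rw [reduceAt_cons_apply, reduceAt_cons_apply, map_sub, setZero, app_map_apply, ih]
    rfl

lemma reduce_eq_zero {n : ℕ} {x : F.chains n} (hx : x ∈ F.degenerate n) : F.reduce n x = 0 := by
  rw [← AddSubgroup.mem_bot]
  refine apply_mem_of_mem_degenerate (F.reduce n) ⊥ (fun m hm i y => ?_) hx
  subst hm
  rw [eqToHom_refl, Category.id_comp, AddSubgroup.mem_bot]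
  exact reduceAt_map_ε i _ (List.mem_finRange i) y

lemma reduce_sub_mem_degenerate {n : ℕ} (x : F.chains n) : F.reduce n x - x ∈ F.degenerate n := by
  cases n with
  | zero => exact (sub_self x).symm ▸ zero_mem _
  | succ n => exact reduceAt_sub_mem_degenerate _ x

lemma app_reduce (φ : F ⟶ G) (n : ℕ) (x : F.chains n) :
    (φ.app (op ⟨n⟩)).hom (F.reduce n x) = G.reduce n ((φ.app (op ⟨n⟩)).hom x) := by
  cases n with
  | zero => rfl
  | succ n => exact app_reduceAt φ _ x

/-- The homomorphism induced on normalized chains. -/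
def normalizedMap (φ : F ⟶ G) (n : ℕ) : F.normalizedChains n ⟶ G.normalizedChains n :=
  AddCommGrpCat.ofHom (QuotientAddGroup.map (F.degenerate n) (G.degenerate n)
    (φ.app (op ⟨n⟩)).hom fun _ hx => app_mem_degenerate φ hx)

/-- The class of a chain in the normalized chains. -/
def toNormalized (F : CubicalAbGroup.{u}) (n : ℕ) : F.chains n →+ F.normalizedChains n :=
  QuotientAddGroup.mk' (F.degenerate n)

lemma toNormalized_surjective (n : ℕ) : Function.Surjective (F.toNormalized n) :=
  QuotientAddGroup.mk'_surjective _

lemma toNormalized_eq_zero_iff {n : ℕ} {x : F.chains n} :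
    F.toNormalized n x = 0 ↔ x ∈ F.degenerate n :=
  QuotientAddGroup.eq_zero_iff x

lemma normalizedD_toNormalized (n : ℕ) (x : F.chains (n + 1)) :
    (F.normalizedD n).hom (F.toNormalized (n + 1) x) =
      F.toNormalized n ((F.d n).hom x) := rfl

lemma normalizedChains_hom_ext {n : ℕ} {A : AddCommGrpCat.{u}} {f g : F.normalizedChains n ⟶ A}
    (h : ∀ x, f.hom (F.toNormalized n x) = g.hom (F.toNormalized n x)) : f = g := by
  refine AddCommGrpCat.hom_ext (AddMonoidHom.ext fun x => ?_)
  obtain ⟨x, rfl⟩ := toNormalized_surjective n x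
  exact h x

lemma normalizedComplex_d (F : CubicalAbGroup.{u}) (n : ℕ) :
    F.normalizedComplex.d (n + 1) n = F.normalizedD n :=
  ChainComplex.of_d _ _ n

end

/-- The functor of normalized complexes. -/
noncomputable def normalized : CubicalAbGroup.{u} ⥤ ChainComplex AddCommGrpCat.{u} ℕ where
  obj F := F.normalizedComplex
  map {F G} φ := ChainComplex.ofHom (X := F.normalizedComplex) (Y := G.normalizedComplex)
    (normalizedMap φ) fun n => by
      rw [normalizedComplex_d, normalizedComplex_d]
      refine normalizedChains_hom_ext fun x => ?_
      exact congrArg (G.toNormalized n) (app_d_apply φ n x).symm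
  map_id F := by
    ext n : 1
    exact normalizedChains_hom_ext fun x => rfl
  map_comp φ ψ := by
    ext n : 1
    exact normalizedChains_hom_ext fun x => rfl

instance : (normalized.{u}).PreservesZeroMorphisms where
  map_zero F G := by
    ext n : 1
    exact normalizedChains_hom_ext fun x => map_zero (G.toNormalized n)

/-- Evaluation at a cube is exact, and the natural operator `reduce` turns a congruence modulo
degenerate chains into an equality of chains. -/
lemma shortExact_map_normalized (S : ShortComplex CubicalAbGroup.{u}) (hS : S.ShortExact) :
    (S.map normalized).ShortExact := by
  refine HomologicalComplex.shortExact_of_degreewise_shortExact _ fun n => ?_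
  have hn := hS.map_of_exact ((evaluation _ AddCommGrpCat.{u}).obj (op (⟨n⟩ : Cube)))
  have hf : Function.Injective (S.f.app (op ⟨n⟩)).hom := hn.ab_injective_f
  have hg : Function.Surjective (S.g.app (op ⟨n⟩)).hom := hn.ab_surjective_g
  have hfg := (ShortComplex.ab_exact_iff _).1 hn.exact
  refine ShortComplex.ShortExact.mk' ?_ ?_ ?_
  · rw [ShortComplex.ab_exact_iff]
    intro y hy
    obtain ⟨y, rfl⟩ := toNormalized_surjective n y
    have hy' := toNormalized_eq_zero_iff.1 hy
    -- The chain `y` is sent only into the degenerate chains, but its representative `reduce y` is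
    -- sent to `0`, so it lifts.
    obtain ⟨x, hx⟩ := hfg (S.X₂.reduce n y)
      ((app_reduce S.g n y).trans (reduce_eq_zero hy'))
    refine ⟨S.X₁.toNormalized n x, ?_⟩
    refine (congrArg (S.X₂.toNormalized n) hx).trans ?_
    rw [← sub_eq_zero, ← map_sub, toNormalized_eq_zero_iff]
    exact reduce_sub_mem_degenerate y
  · refine (AddCommGrpCat.mono_iff_injective _).2 ((injective_iff_map_eq_zero _).2 fun x hx => ?_)
    obtain ⟨x, rfl⟩ := toNormalized_surjective n x
    have hx' := toNormalized_eq_zero_iff.1 hx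
    have h := reduce_eq_zero hx'
    rw [← app_reduce] at h
    have h' := reduce_sub_mem_degenerate x
    rw [(injective_iff_map_eq_zero _).1 hf _ h, zero_sub] at h'
    exact toNormalized_eq_zero_iff.2 (neg_mem_iff.1 h')
  · refine (AddCommGrpCat.epi_iff_surjective _).2 fun z => ?_
    obtain ⟨z, rfl⟩ := toNormalized_surjective n z
    obtain ⟨y, rfl⟩ := hg z
    exact ⟨S.X₂.toNormalized n y, rfl⟩

lemma isZero_homology_normalized (P : CubicalAbGroup.{u}) [Projective P] (n : ℕ) :
    IsZero ((normalized.obj P).homology (n + 1)) := by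
  rw [← HomologicalComplex.exactAt_iff_isZero_homology,
    HomologicalComplex.exactAt_iff' _ (n + 2) (n + 1) n (by simp) (by simp),
    ShortComplex.ab_exact_iff]
  intro z hz
  obtain ⟨z, rfl⟩ := P.toNormalized_surjective (n + 1) z
  have hz' : (P.d n).hom z ∈ P.degenerate n := by
    rw [← toNormalized_eq_zero_iff, ← normalizedD_toNormalized, ← normalizedComplex_d]
    exact hz
  obtain ⟨w, hw⟩ := P.exists_d_sub_mem_degenerate n z hz'
  refine ⟨P.toNormalized _ w, ?_⟩
  change (P.normalizedComplex.d (n + 2) (n + 1)).hom _ = _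
  rw [normalizedComplex_d]
  refine (normalizedD_toNormalized _ _).trans ?_
  rw [← sub_eq_zero, ← map_sub, toNormalized_eq_zero_iff]
  exact hw

end CubicalAbGroup

/-! ### The colimit as homology in degree zero -/

namespace Cube

/-- The vertex of the cube with all coordinates `0`. -/
def zeroVertex : ∀ n : ℕ, (⟨0⟩ : Cube) ⟶ ⟨n⟩
  | 0 => 𝟙 _
  | n + 1 => zeroVertex n ≫ δ 0 0

end Cube

namespace CubicalAbGroup

variable {F G : CubicalAbGroup.{u}}

lemma map_δ_sub_mem_range (x : F.chains 1) :
    (F.map (Cube.δ 0 0).op).hom x - (F.map (Cube.δ 0 1).op).hom x ∈ (F.d 0).hom.range := by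
  -- The single face direction of an edge enters `d` with the sign `(-1)^(0 + 1)`.
  refine ⟨-x, ?_⟩
  rw [map_neg, d_apply]
  simp

/-- Induction on the dimension: the edge `cons w` joins a vertex `w ≫ δ 0 1` to `w ≫ δ 0 0`, which
lies in a cube of smaller dimension. -/
lemma map_vertex_sub_mem_range {n : ℕ} (v : (⟨0⟩ : Cube) ⟶ ⟨n⟩) (x : F.chains n) :
    (F.map v.op).hom x - (F.map (Cube.zeroVertex n).op).hom x ∈ (F.d 0).hom.range := by
  induction n with
  | zero =>
    have h : v = Cube.zeroVertex 0 := Cube.hom_ext fun y => Subsingleton.elim _ _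
    rw [h, sub_self]
    exact zero_mem _
  | succ n ih =>
    rcases Cube.eq_face_or_cons_or_degenerate v with ⟨τ, w, rfl⟩ | ⟨p, hp, _⟩
    · have h₀ := ih w ((F.map (Cube.δ 0 0).op).hom x)
      have h₁ := map_δ_sub_mem_range ((F.map (Cube.cons w).op).hom x)
      rw [map_comp_apply, map_comp_apply] at h₀ h₁
      rw [Cube.δ_zero_comp_cons, Cube.δ_zero_comp_cons] at h₁
      have hτ : τ = 0 ∨ τ = 1 := by lia
      rcases hτ with rfl | rfl
      · exact h₀
      · convert sub_mem h₀ h₁ using 1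
        rw [sub_sub_sub_cancel_left]
        rfl
    · lia

/-- The quotient of the group of vertices by the boundaries of the edges. -/
abbrev components (F : CubicalAbGroup.{u}) : AddCommGrpCat.{u} :=
  AddCommGrpCat.of (F.chains 0 ⧸ (F.d 0).hom.range)

/-- The cocone that maps a cube to the class of any of its vertices. -/
def componentsCocone (F : CubicalAbGroup.{u}) : Cocone F where
  pt := F.components
  ι :=
    { app X := AddCommGrpCat.ofHom ((QuotientAddGroup.mk' (F.d 0).hom.range).comp
        (F.map (Cube.zeroVertex X.unop.dim).op).hom)
      naturality X Y f := by
        refine AddCommGrpCat.hom_ext (AddMonoidHom.ext fun x => ?_)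
        refine QuotientAddGroup.eq_iff_sub_mem.2 ?_
        have h := map_vertex_sub_mem_range (Cube.zeroVertex Y.unop.dim ≫ f.unop) x
        rw [← map_comp_apply] at h
        exact h }

lemma map_ι_vertex (s : Cocone F) {n : ℕ} (v : (⟨0⟩ : Cube) ⟶ ⟨n⟩) (x : F.chains n) :
    (s.ι.app (op ⟨0⟩)).hom ((F.map v.op).hom x) = (s.ι.app (op ⟨n⟩)).hom x :=
  congrArg (fun k => k.hom x) (s.w v.op)

lemma d_comp_ι (s : Cocone F) : F.d 0 ≫ s.ι.app (op ⟨0⟩) = 0 := by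
  refine AddCommGrpCat.hom_ext (AddMonoidHom.ext fun x => ?_)
  change (s.ι.app (op ⟨0⟩)).hom ((F.d 0).hom x) = 0
  rw [d_apply, Fin.sum_univ_one, map_zsmul, map_sub, map_ι_vertex, map_ι_vertex, sub_self,
    smul_zero]

/-- The morphism from the group of vertices to the colimit, on the normalized complex. -/
noncomputable def normalizedToColim (F : CubicalAbGroup.{u}) :
    (normalized.obj F).X 0 ⟶ colim.obj F :=
  AddCommGrpCat.ofHom (QuotientAddGroup.lift (F.degenerate 0) (colimit.ι F (op ⟨0⟩)).hom bot_le)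

lemma d_comp_normalizedToColim (F : CubicalAbGroup.{u}) :
    (normalized.obj F).d 1 0 ≫ F.normalizedToColim = 0 := by
  change F.normalizedComplex.d 1 0 ≫ _ = 0
  rw [normalizedComplex_d]
  refine normalizedChains_hom_ext fun x => ?_
  exact congrArg (fun k => k.hom x) (d_comp_ι (colimit.cocone F))

/-- The group of vertices of the normalized complex maps onto the colimit with kernel the
boundaries of the edges. -/
lemma exact_normalizedToColim (F : CubicalAbGroup.{u}) :
    (ShortComplex.mk _ _ F.d_comp_normalizedToColim).Exact := by
  rw [ShortComplex.ab_exact_iff]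
  intro x hx
  obtain ⟨x, rfl⟩ := F.toNormalized_surjective 0 x
  -- A vertex chain that vanishes in the colimit vanishes under every cocone, in particular in
  -- `components`, where vanishing means being a boundary.
  have h : (F.componentsCocone.ι.app (op ⟨0⟩)).hom x = 0 := by
    rw [← colimit.ι_desc F.componentsCocone]
    exact (congrArg (colimit.desc F F.componentsCocone).hom hx).trans (map_zero _)
  have h' : (F.componentsCocone.ι.app (op ⟨0⟩)).hom x =
      QuotientAddGroup.mk' (F.d 0).hom.range x :=
    congrArg (QuotientAddGroup.mk' (F.d 0).hom.range)
      (congrArg (fun k => k.hom x) (F.map_id (op ⟨0⟩)))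
  replace h := (QuotientAddGroup.eq_zero_iff x).1 (h'.symm.trans h)
  obtain ⟨y, rfl⟩ := h
  refine ⟨F.toNormalized 1 y, ?_⟩
  change (F.normalizedComplex.d 1 0).hom _ = _
  rw [normalizedComplex_d]
  rfl

/-- In the colimit an element of `F(𝕀ⁿ)` is identified with its restriction to a vertex, so the
vertices already generate. -/
instance epi_normalizedToColim (F : CubicalAbGroup.{u}) : Epi F.normalizedToColim where
  left_cancellation g h hgh := by
    refine colimit.hom_ext fun X => AddCommGrpCat.hom_ext (AddMonoidHom.ext fun x => ?_)
    let v := Cube.zeroVertex X.unop.dim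
    have hx : (colimit.ι F X).hom x = (colimit.ι F (op ⟨0⟩)).hom ((F.map v.op).hom x) :=
      (map_ι_vertex (colimit.cocone F) v x).symm
    change g.hom ((colimit.ι F X).hom x) = h.hom ((colimit.ι F X).hom x)
    rw [hx]
    exact congrArg (fun k => k.hom (F.toNormalized 0 ((F.map v.op).hom x))) hgh

lemma normalizedToColim_naturality (φ : F ⟶ G) :
    (normalized.map φ).f 0 ≫ G.normalizedToColim = F.normalizedToColim ≫ colim.map φ :=
  normalizedChains_hom_ext fun x =>
    (congrArg (fun k => k.hom x) (ι_colimMap φ (op (⟨0⟩ : Cube)))).symm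

/-- The zeroth homology of the normalized complex is the colimit. -/
noncomputable def normalizedOpcyclesIso (F : CubicalAbGroup.{u}) :
    (normalized.obj F).opcycles 0 ≅ colim.obj F :=
  ((normalized.obj F).opcyclesIsCokernel 1 0 (by simp)).coconePointUniqueUpToIso
    (have : Epi (ShortComplex.mk _ _ F.d_comp_normalizedToColim).g := F.epi_normalizedToColim
     F.exact_normalizedToColim.gIsCokernel)

lemma pOpcycles_normalizedOpcyclesIso_hom (F : CubicalAbGroup.{u}) :
    (normalized.obj F).pOpcycles 0 ≫ F.normalizedOpcyclesIso.hom = F.normalizedToColim :=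
  IsColimit.comp_coconePointUniqueUpToIso_hom
    ((normalized.obj F).opcyclesIsCokernel 1 0 (by simp)) _ WalkingParallelPair.one

/-- The zeroth homology of the normalized complex is naturally isomorphic to the colimit. -/
noncomputable def normalizedHomologyZeroIso :
    normalized.{u} ⋙ HomologicalComplex.homologyFunctor _ _ 0 ≅ colim :=
  NatIso.ofComponents
    (fun F => (normalized.obj F).isoHomologyι₀ ≪≫ F.normalizedOpcyclesIso)
    (fun {F G} φ => by
      change HomologicalComplex.homologyMap (normalized.map φ) 0 ≫
        (normalized.obj G).homologyι 0 ≫ G.normalizedOpcyclesIso.hom =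
        ((normalized.obj F).homologyι 0 ≫ F.normalizedOpcyclesIso.hom) ≫ colim.map φ
      rw [HomologicalComplex.homologyι_naturality_assoc, Category.assoc]
      congr 1
      rw [← cancel_epi ((normalized.obj F).pOpcycles 0),
        HomologicalComplex.p_opcyclesMap_assoc, pOpcycles_normalizedOpcyclesIso_hom,
        normalizedToColim_naturality, reassoc_of% F.pOpcycles_normalizedOpcyclesIso_hom])

end CubicalAbGroup

/-! ### Computing left derived functors by dimension shifting -/

namespace CategoryTheory

section

variable {A B : Type*} [Category* A] [Category* B] [Abelian A] [Abelian B]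

/-- The short complex `0 ⟶ opcycles (n + 1) ⟶ K n ⟶ opcycles n ⟶ 0`. -/
noncomputable def opcyclesShortComplex (K : ChainComplex A ℕ) (n : ℕ) : ShortComplex A :=
  ShortComplex.mk (K.fromOpcycles (n + 1) n) (K.pOpcycles n) (by
    rw [← cancel_epi (K.pOpcycles (n + 1)), HomologicalComplex.p_fromOpcycles_assoc,
      HomologicalComplex.d_pOpcycles, comp_zero])

/-- The kernel of `opcycles (n + 1) ⟶ K n` is the homology in degree `n + 1`, and its image is that
of the differential because `pOpcycles` is epi. -/
lemma shortExact_opcyclesShortComplex (K : ChainComplex A ℕ) (n : ℕ) (hK : K.ExactAt (n + 1)) :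
    (opcyclesShortComplex K n).ShortExact := by
  refine ShortComplex.ShortExact.mk' ?_ ?_ ?_
  · have h : (ShortComplex.mk (K.d (n + 1) n) (K.pOpcycles n) (by simp)).Exact :=
      ShortComplex.exact_of_g_is_cokernel _ (K.opcyclesIsCokernel (n + 1) n (by simp))
    let φ : ShortComplex.mk (K.d (n + 1) n) (K.pOpcycles n) (by simp) ⟶
        opcyclesShortComplex K n :=
      { τ₁ := K.pOpcycles (n + 1)
        τ₂ := 𝟙 _
        τ₃ := 𝟙 _
        comm₁₂ := by simp [opcyclesShortComplex]
        comm₂₃ := by simp [opcyclesShortComplex] }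
    have : Epi φ.τ₁ := inferInstanceAs (Epi (K.pOpcycles (n + 1)))
    have : IsIso φ.τ₂ := inferInstanceAs (IsIso (𝟙 _))
    have : Mono φ.τ₃ := inferInstanceAs (Mono (𝟙 _))
    exact (ShortComplex.exact_iff_of_epi_of_isIso_of_mono φ).1 h
  · refine Preadditive.mono_of_isZero_kernel' _ (K.homologyIsKernel (n + 1) n (by simp)) ?_
    exact hK.isZero_homology
  · exact inferInstanceAs (Epi (K.pOpcycles n))

/-- The homology of a short complex is the kernel of the morphism that its second morphism
induces on a cokernel of the first one. -/
noncomputable def ShortComplex.homologyIsoKernel (S : ShortComplex B) {Q : B} (p : S.X₂ ⟶ Q)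
    (wp : S.f ≫ p = 0) (hp : IsColimit (CokernelCofork.ofπ p wp)) (i : Q ⟶ S.X₃)
    (hi : p ≫ i = S.g) : S.homology ≅ kernel i := by
  have hdesc : hp.desc (CokernelCofork.ofπ _ S.zero) = i :=
    Cofork.IsColimit.hom_ext hp ((hp.fac _ WalkingParallelPair.one).trans hi.symm)
  exact ShortComplex.RightHomologyData.homologyIso
    { Q := Q
      H := kernel (hp.desc (CokernelCofork.ofπ _ S.zero))
      p := p
      ι := kernel.ι _
      wp := wp
      hp := hp
      wι := kernel.condition _
      hι := kernelIsKernel _ } ≪≫ kernelIsoOfEq hdesc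

/-- A right exact functor identifies the homology of the image of a complex with the kernel of
the image of `opcycles (n + 1) ⟶ K n`. -/
noncomputable def mapHomologyIsoKernel (L : A ⥤ B) [L.Additive] [PreservesFiniteColimits L]
    (K : ChainComplex A ℕ) (n : ℕ) :
    ((L.mapHomologicalComplex _).obj K).homology (n + 1) ≅
      kernel (L.map (K.fromOpcycles (n + 1) n)) :=
  let C := (L.mapHomologicalComplex _).obj K
  ShortComplex.homologyMapIso (C.isoSc' (n + 2) (n + 1) n (by simp) (by simp)) ≪≫
    ShortComplex.homologyIsoKernel (C.sc' (n + 2) (n + 1) n) (L.map (K.pOpcycles (n + 1)))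
      (by
        change L.map (K.d (n + 2) (n + 1)) ≫ L.map (K.pOpcycles (n + 1)) = 0
        rw [← L.map_comp, HomologicalComplex.d_pOpcycles, L.map_zero])
      (CokernelCofork.mapIsColimit _ (K.opcyclesIsCokernel (n + 2) (n + 1) (by simp)) L)
      (L.map (K.fromOpcycles (n + 1) n))
      (by
        change L.map (K.pOpcycles (n + 1)) ≫ L.map (K.fromOpcycles (n + 1) n) = L.map (K.d (n + 1) n)
        rw [← L.map_comp, HomologicalComplex.p_fromOpcycles])

/-- Dimension shifting along the short exact sequences
`0 ⟶ opcycles (m + 1) ⟶ K m ⟶ opcycles m ⟶ 0`. -/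
lemma nonempty_homology_opcycles_iso (N : A ⥤ ChainComplex B ℕ) [N.PreservesZeroMorphisms]
    (hN : ∀ S : ShortComplex A, S.ShortExact → (S.map N).ShortExact)
    (K : ChainComplex A ℕ) (hK : ∀ n, K.ExactAt (n + 1))
    (hP : ∀ m n : ℕ, IsZero ((N.obj (K.X m)).homology (n + 1))) (n m : ℕ) :
    Nonempty ((N.obj (K.opcycles m)).homology (n + 1) ≅
      (N.obj (K.opcycles (m + n))).homology 1) := by
  induction n generalizing m with
  | zero => exact ⟨Iso.refl _⟩
  | succ n ih =>
    obtain ⟨i⟩ := ih (m + 1)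
    have hS := hN _ (shortExact_opcyclesShortComplex K m (hK m))
    -- The homology of `N (K m)` vanishes in both degrees around the connecting morphism, which is
    -- therefore an isomorphism.
    refine ⟨hS.δIso (n + 2) (n + 1) (by simp) (hP m (n + 1)) (hP m n) ≪≫ i ≪≫ eqToIso ?_⟩
    rw [Nat.add_right_comm, Nat.add_assoc]

/-- An exact functor to chain complexes whose homology vanishes in positive degrees on projective
objects computes the left derived functors of its homology in degree `0`. -/
theorem nonempty_homology_iso_leftDerived [EnoughProjectives A]
    (L : A ⥤ B) [L.Additive] [PreservesFiniteColimits L]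
    (N : A ⥤ ChainComplex B ℕ) [N.PreservesZeroMorphisms]
    (hN : ∀ S : ShortComplex A, S.ShortExact → (S.map N).ShortExact)
    (hP : ∀ (P : A) [Projective P] (n : ℕ), IsZero ((N.obj P).homology (n + 1)))
    (e : N ⋙ HomologicalComplex.homologyFunctor B _ 0 ≅ L) (X : A) (n : ℕ) :
    Nonempty ((N.obj X).homology n ≅ (L.leftDerived n).obj X) := by
  cases n with
  | zero => exact ⟨(e ≪≫ L.leftDerivedZeroIsoSelf.symm).app X⟩
  | succ n =>
    let P := projectiveResolution X
    let K := P.complex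
    -- The augmentation of the resolution makes `X` a cokernel of the differential from degree `1`.
    let i₀ : X ≅ K.opcycles 0 := P.isColimitCokernelCofork.coconePointUniqueUpToIso
      (K.opcyclesIsCokernel 1 0 (by simp))
    obtain ⟨i₁⟩ := nonempty_homology_opcycles_iso N hN K P.complex_exactAt_succ
      (fun m n => hP (K.X m) n) n 0
    rw [zero_add] at i₁
    have hS := hN _ (shortExact_opcyclesShortComplex K n (P.complex_exactAt_succ n))
    have h₁ : (ComplexShape.down ℕ).Rel 1 0 := by simp
    -- Here only the degree `1` homology of `N (K n)` vanishes, so the connecting morphism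
    -- identifies the homology of `N (opcycles n)` in degree `1` with a kernel in degree `0`. By `e`
    -- and `mapHomologyIsoKernel` this kernel is also the homology of `L K` in degree `n + 1`.
    have : Mono (hS.δ 1 0 h₁) := hS.mono_δ 1 0 h₁ (hP (K.X n) 0)
    let i₂ : (N.obj (K.opcycles n)).homology 1 ≅
        kernel ((N ⋙ HomologicalComplex.homologyFunctor B _ 0).map (K.fromOpcycles (n + 1) n)) :=
      (hS.homology_exact₁ 1 0 h₁).fIsKernel.conePointUniqueUpToIso (limit.isLimit _)
    let i₃ : kernel ((N ⋙ HomologicalComplex.homologyFunctor B _ 0).map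
        (K.fromOpcycles (n + 1) n)) ≅ kernel (L.map (K.fromOpcycles (n + 1) n)) :=
      kernel.mapIso _ _ (e.app _) (e.app _) (e.hom.naturality _)
    exact ⟨(N ⋙ HomologicalComplex.homologyFunctor B _ (n + 1)).mapIso i₀ ≪≫ i₁ ≪≫ i₂ ≪≫ i₃ ≪≫
      (mapHomologyIsoKernel L K n).symm ≪≫ (P.isoLeftDerivedObj L (n + 1)).symm⟩

end

end CategoryTheory
theorem corollary1 (F : CubicalAbGroup.{u}) (n : ℕ) :
    Nonempty (F.normalizedComplex.homology n ≅ (colimDerived Cubeᵒᵖ n).obj F) :=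
  nonempty_homology_iso_leftDerived colim CubicalAbGroup.normalized
    CubicalAbGroup.shortExact_map_normalized
    (fun P _ n => CubicalAbGroup.isZero_homology_normalized P n)
    CubicalAbGroup.normalizedHomologyZeroIso F n
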